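/- Let $N\ge 1$, and let $V=(v_{ij})_{1\le i,j\le N}$ be an $N\times N$ COE matrix (circular orthogonal ensemble), that is, a random symmetric unitary $N\times N$ complex matrix whose distribution is invariant under $V\mapsto U_0^{\mathsf T}\,V\,U_0$ for every fixed unitary $N\times N$ matrix $U_0$. Then for every $1\le i\le N$ and every $n\ge 1$, the random variable $|v_{ii}|^{2n}$ is integrable and $$\mathbb{E}\big[|v_{ii}|^{2n}\big]=\frac{2^n\,n!}{(N+1)(N+3)\cdots(N+2n-1)}=\frac{2^n\,n!}{\prod_{k=1}^{n}(N+2k-1)}.$$ -/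

import Mathlib

open MeasureTheory

/-- The product (entrywise) sigma-algebra on complex matrices; it is the Borel sigma-algebra. -/
noncomputable instance Matrix.instMeasurableSpaceComplex {m n : Type*} : MeasurableSpace (Matrix m n ℂ) :=
  MeasurableSpace.pi

/-- `V` is an `N × N` COE matrix on the probability space `(Ω, P)`: a random symmetric unitary
matrix whose law is invariant under `V ↦ U₀ᵀ V U₀` for every fixed unitary matrix `U₀`. -/
structure IsCOE {Ω : Type*} [MeasurableSpace Ω] (P : Measure Ω) {N : ℕ}
    (V : Ω → Matrix (Fin N) (Fin N) ℂ) : Prop where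
  isProbabilityMeasure : IsProbabilityMeasure P
  aemeasurable : AEMeasurable V P
  isSymm : ∀ᵐ ω ∂P, (V ω).IsSymm
  unitary : ∀ᵐ ω ∂P, V ω ∈ Matrix.unitaryGroup (Fin N) ℂ
  map_conj : ∀ U₀ ∈ Matrix.unitaryGroup (Fin N) ℂ,
    P.map (fun ω => U₀.transpose * V ω * U₀) = P.map V

/-!
The diagonal moments `m n = E |vᵢᵢ| ^ (2 n)` satisfy `(N + 2 n + 1) * m (n + 1) = 2 (n + 1) * m n`
(`IsCOE.moment_succ`), and `m 0 = 1`.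

Invariance under `V ↦ Uᵀ V U` makes the moments of the quadratic form `xᵀ V x` depend on `x` only
through its norm: `E |xᵀ V x| ^ (2 n) = ‖x‖ ^ (4 n) * m n` (`IsCOE.integral_norm_form_pow`).
The recursion is what the complex Laplacian of this identity in `x` says, since the gradient of
`xᵀ V x` is `2 V x`, of norm `2 ‖x‖`. In place of the Laplacian, the identity is taken at
`x = eᵢ + r z eⱼ` with `j ≠ i`, where both sides are polynomials in the real variable `r`. The
coefficients of `r ^ 2`, added for `z = 1` and `z = I`, give
`2 (n + 1) * E (|vᵢᵢ| ^ (2 n) * |vᵢⱼ| ^ 2) = m (n + 1)` (`IsCOE.integral_offdiag`). Summing over `j`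
and using that the rows of `V` are unit vectors yields the recursion.
-/

/-! ### Coefficients of polynomials -/

open Polynomial in
/-- Expectation commutes with taking a coefficient of a random polynomial of bounded degree: by
Lagrange interpolation, a coefficient is a fixed linear combination of finitely many values. -/
theorem integral_coeff_eq {Ω : Type*} [MeasurableSpace Ω] {μ : Measure Ω} {d : ℕ}
    (p : Ω → ℂ[X]) (q : ℂ[X]) (hp : ∀ ω, (p ω).natDegree ≤ d) (hq : q.natDegree ≤ d)
    (hint : ∀ r : ℝ, Integrable (fun ω => (p ω).eval (r : ℂ)) μ)
    (heq : ∀ r : ℝ, ∫ ω, (p ω).eval (r : ℂ) ∂μ = q.eval (r : ℂ)) (k : ℕ) :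
    Integrable (fun ω => (p ω).coeff k) μ ∧ ∫ ω, (p ω).coeff k ∂μ = q.coeff k := by
  set nodes : ℕ → ℂ := fun t => ((t : ℝ) : ℂ)
  have hinj : Set.InjOn nodes (Finset.range (d + 1)) := by
    intro a _ b _ h
    simpa [nodes] using h
  have key : ∀ f : ℂ[X], f.natDegree ≤ d → f.coeff k =
      ∑ t ∈ Finset.range (d + 1), f.eval (nodes t) *
        (Lagrange.basis (Finset.range (d + 1)) nodes t).coeff k := by
    intro f hf
    have hdeg : f.degree < (Finset.range (d + 1)).card := by
      rw [Finset.card_range]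
      exact lt_of_le_of_lt degree_le_natDegree (by exact_mod_cast Nat.lt_succ_of_le hf)
    conv_lhs => rw [Lagrange.eq_interpolate hinj hdeg]
    simp [Lagrange.interpolate_apply]
  have hI : ∀ t ∈ Finset.range (d + 1), Integrable (fun ω => (p ω).eval (nodes t) *
        (Lagrange.basis (Finset.range (d + 1)) nodes t).coeff k) μ :=
    fun t _ => (hint t).mul_const _
  have hfun : (fun ω => (p ω).coeff k) = fun ω => ∑ t ∈ Finset.range (d + 1),
      (p ω).eval (nodes t) * (Lagrange.basis (Finset.range (d + 1)) nodes t).coeff k :=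
    funext fun ω => key _ (hp ω)
  rw [hfun, key q hq]
  refine ⟨integrable_finsetSum _ hI, ?_⟩
  rw [integral_finsetSum _ hI]
  refine Finset.sum_congr rfl fun t _ => ?_
  rw [integral_mul_const]
  exact congrArg (· * _) (heq t)

open Polynomial in
theorem coeff_one_pow_succ {R : Type*} [CommRing R] (p : R[X]) (n : ℕ) :
    (p ^ (n + 1)).coeff 1 = (n + 1) * p.coeff 0 ^ n * p.coeff 1 := by
  induction n with
  | zero => simp
  | succ n ih =>
    rw [pow_succ, mul_coeff_one, ih, coeff_zero_eq_eval_zero, coeff_zero_eq_eval_zero, eval_pow]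
    push_cast
    ring

open Polynomial ComplexConjugate in
/-- The coefficient of `r ^ 2` in `|p (r * z)| ^ 2` is `2 Re (p₀ p̄₂ z̄ ^ 2) + |p₁| ^ 2` for `|z| = 1`.
Adding the values at `z = 1` and `z = I` cancels the first term. -/
theorem coeff_two_normSq_add (p : ℂ[X]) :
    (p.comp (C 1 * X) * (p.map (starRingEnd ℂ)).comp (C (conj 1) * X) +
      p.comp (C Complex.I * X) * (p.map (starRingEnd ℂ)).comp (C (conj Complex.I) * X)).coeff 2 =
      2 * (‖p.coeff 1‖ : ℂ) ^ 2 := by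
  rw [← Complex.mul_conj']
  simp only [coeff_add, coeff_mul, Finset.Nat.antidiagonal_succ, comp_C_mul_X_coeff, coeff_map]
  simp
  ring_nf
  simp
  ring

open Polynomial ComplexConjugate in
/-- For a real variable `r`, the function `|p (r * z)| ^ 2` is the polynomial
`p (r * z) * p̄ (r * z̄)`. -/
theorem eval_normSq (p : ℂ[X]) (z : ℂ) (r : ℝ) :
    (p.comp (C z * X) * (p.map (starRingEnd ℂ)).comp (C (conj z) * X)).eval (r : ℂ) =
      ((‖p.eval (r * z)‖ ^ 2 : ℝ) : ℂ) := by
  have : (p.map (starRingEnd ℂ)).eval (conj (r * z)) = conj (p.eval (r * z)) := by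
    rw [eval_map, eval₂_at_apply]
  rw [eval_mul, eval_comp, eval_comp]
  simp only [eval_mul, eval_C, eval_X]
  rw [map_mul, Complex.conj_ofReal] at this
  rw [mul_comm (conj z), this, mul_comm z, Complex.mul_conj']
  push_cast
  rfl

/-! ### Unitary matrices -/

/-- Every unit vector is the `i`-th column of a unitary matrix. -/
theorem exists_unitary_col {N : ℕ} (i : Fin N) (x : Fin N → ℂ) (hx : ∑ k, ‖x k‖ ^ 2 = 1) :
    ∃ U ∈ Matrix.unitaryGroup (Fin N) ℂ, ∀ k, U k i = x k := by
  have hx' : ‖WithLp.toLp 2 x‖ = 1 := by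
    rw [EuclideanSpace.norm_eq]; simp [hx]
  obtain ⟨b, hb⟩ := Orthonormal.exists_orthonormalBasis_extension_of_card_eq (𝕜 := ℂ)
    (E := EuclideanSpace ℂ (Fin N)) (by simp) (v := fun _ : Fin N => WithLp.toLp 2 x) (s := {i})
    (by
      constructor
      · rintro ⟨a, ha⟩; simpa using hx'
      · rintro ⟨a, ha⟩ ⟨b, hb⟩ hab; exact absurd (Subtype.ext (ha.trans hb.symm)) hab)
  refine ⟨_, (EuclideanSpace.basisFun (Fin N) ℂ).toMatrix_orthonormalBasis_mem_unitary b,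
    fun k => ?_⟩
  simp [Module.Basis.toMatrix_apply, hb i rfl]

theorem measurable_entry {N : ℕ} (k l : Fin N) :
    Measurable fun A : Matrix (Fin N) (Fin N) ℂ => A k l :=
  (measurable_pi_apply l).comp (measurable_pi_apply k)

theorem sum_norm_sq_single {i j : Fin N} (hij : i ≠ j) (w : ℂ) :
    ∑ k, ‖(Pi.single i 1 + Pi.single j w : Fin N → ℂ) k‖ ^ 2 = 1 + ‖w‖ ^ 2 := by
  have : ∀ k, ‖(Pi.single i 1 + Pi.single j w : Fin N → ℂ) k‖ ^ 2 =
      (if k = i then 1 else 0) + (if k = j then ‖w‖ ^ 2 else 0) := by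
    intro k
    by_cases h1 : k = i
    · subst h1; simp [hij]
    · by_cases h2 : k = j
      · subst h2; simp [h1]
      · simp [h1, h2]
  rw [Finset.sum_congr rfl fun k _ => this k]
  simp [Finset.sum_add_distrib]

/-! ### Moments of the diagonal entries -/

namespace IsCOE
variable {Ω : Type*} [MeasurableSpace Ω] {P : Measure Ω} {N : ℕ}
    {V : Ω → Matrix (Fin N) (Fin N) ℂ}

theorem aemeasurable_entry (hV : IsCOE P V) (k l : Fin N) : AEMeasurable (fun ω => V ω k l) P :=
  (measurable_entry k l).comp_aemeasurable hV.aemeasurable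

theorem norm_entry_le (hV : IsCOE P V) : ∀ᵐ ω ∂P, ∀ k l, ‖V ω k l‖ ≤ 1 :=
  hV.unitary.mono fun _ h k l => entry_norm_bound_of_unitary h k l

theorem integral_comp_conj (hV : IsCOE P V) {U : Matrix (Fin N) (Fin N) ℂ}
    (hU : U ∈ Matrix.unitaryGroup (Fin N) ℂ) {f : Matrix (Fin N) (Fin N) ℂ → ℝ}
    (hf : Measurable f) :
    ∫ ω, f (U.transpose * V ω * U) ∂P = ∫ ω, f (V ω) ∂P := by
  have hm : AEMeasurable (fun ω => U.transpose * V ω * U) P := by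
    refine aemeasurable_pi_lambda _ fun k => aemeasurable_pi_lambda _ fun l => ?_
    simp only [Matrix.mul_apply]
    exact Finset.aemeasurable_fun_sum _ fun a _ => (Finset.aemeasurable_fun_sum _ fun b _ =>
      (hV.aemeasurable_entry b a).const_mul _).mul_const _
  rw [← integral_map hm hf.aestronglyMeasurable, hV.map_conj U hU,
    integral_map hV.aemeasurable hf.aestronglyMeasurable]

/-- A unit vector is a column of some unitary `U`, so invariance under `V ↦ Uᵀ V U` gives the
random quadratic form `xᵀ V x` the same moments at all unit vectors; homogeneity does the rest. -/
theorem integral_norm_form_pow (hV : IsCOE P V) (i : Fin N) (n : ℕ) (x : Fin N → ℂ) :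
    ∫ ω, ‖x ⬝ᵥ (V ω).mulVec x‖ ^ (2 * n) ∂P =
      (∑ k, ‖x k‖ ^ 2) ^ (2 * n) * ∫ ω, ‖V ω i i‖ ^ (2 * n) ∂P := by
  have := hV.isProbabilityMeasure
  set s : ℝ := ∑ k, ‖x k‖ ^ 2 with hs
  have hs0 : 0 ≤ s := Finset.sum_nonneg fun k _ => by positivity
  rcases hs0.eq_or_lt with h0 | hpos
  · have hx : x = 0 := by
      funext k
      have := (Finset.sum_eq_zero_iff_of_nonneg fun k _ => by positivity).1 h0.symm k
        (Finset.mem_univ k)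
      simpa using this
    rcases Nat.eq_zero_or_pos n with rfl | hn
    · simp
    · simp [hx, ← h0, hn.ne']
  have hsq : (0 : ℝ) < √s := Real.sqrt_pos.2 hpos
  obtain ⟨U, hU, hUx⟩ := exists_unitary_col i (fun k => ((√s : ℝ) : ℂ)⁻¹ * x k) (by
    simp only [norm_mul, mul_pow, ← Finset.mul_sum, ← hs]
    simp [abs_of_pos hsq, Real.sq_sqrt hs0, hpos.ne'])
  have hentry : ∀ A : Matrix (Fin N) (Fin N) ℂ,
      (s : ℂ) * (U.transpose * A * U) i i = x ⬝ᵥ A.mulVec x := by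
    intro A
    have hss : (s : ℂ) = (√s : ℝ) * (√s : ℝ) := by
      rw [← Complex.ofReal_mul, Real.mul_self_sqrt hs0]
    have hne : ((√s : ℝ) : ℂ) ≠ 0 := by exact_mod_cast hsq.ne'
    rw [Matrix.mul_assoc]
    simp only [Matrix.mul_apply, Matrix.transpose_apply, hUx, dotProduct, Matrix.mulVec,
      Finset.mul_sum]
    refine Finset.sum_congr rfl fun a _ => Finset.sum_congr rfl fun b _ => ?_
    rw [hss]
    field_simp
  have hf : Measurable fun A : Matrix (Fin N) (Fin N) ℂ => s ^ (2 * n) * ‖A i i‖ ^ (2 * n) :=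
    ((measurable_entry i i).norm.pow_const _).const_mul _
  rw [← integral_const_mul, ← hV.integral_comp_conj hU hf]
  congr 1 with ω
  rw [← hentry, norm_mul, mul_pow, Complex.norm_real, Real.norm_of_nonneg hs0]

/-- The value of the quadratic form at `eᵢ + w eⱼ`; symmetry of `V` merges the two cross terms. -/
theorem ae_form_eq (hV : IsCOE P V) (i j : Fin N) :
    ∀ᵐ ω ∂P, ∀ w : ℂ, (Pi.single i 1 + Pi.single j w) ⬝ᵥ
      (V ω).mulVec (Pi.single i 1 + Pi.single j w : Fin N → ℂ) =
      V ω i i + 2 * V ω i j * w + V ω j j * w ^ 2 := by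
  filter_upwards [hV.isSymm] with ω h w
  have := h.apply i j
  simp [Matrix.mulVec_add, add_dotProduct, dotProduct_add, this]
  ring

theorem ae_sum_norm_sq (hV : IsCOE P V) (i : Fin N) : ∀ᵐ ω ∂P, ∑ j, ‖V ω i j‖ ^ 2 = 1 := by
  filter_upwards [hV.unitary] with ω h
  have := congrFun (congrFun (Matrix.mem_unitaryGroup_iff.1 h) i) i
  simp only [Matrix.mul_apply, Matrix.star_apply, RCLike.star_def, Complex.mul_conj',
    Matrix.one_apply_eq] at this
  exact_mod_cast this

theorem integrable_norm_pow_mul (hV : IsCOE P V) (i j : Fin N) (a b : ℕ) :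
    Integrable (fun ω => ‖V ω i i‖ ^ a * ‖V ω i j‖ ^ b) P := by
  have := hV.isProbabilityMeasure
  refine Integrable.of_bound (((hV.aemeasurable_entry i i).norm.pow_const a).mul
    ((hV.aemeasurable_entry i j).norm.pow_const b)).aestronglyMeasurable 1 ?_
  filter_upwards [hV.norm_entry_le] with ω h
  rw [Real.norm_of_nonneg (by positivity)]
  exact mul_le_one₀ (pow_le_one₀ (norm_nonneg _) (h _ _)) (by positivity)
    (pow_le_one₀ (norm_nonneg _) (h _ _))

open Polynomial ComplexConjugate in
/-- The relation between the diagonal and a mixed moment obtained from the coefficient of `r ^ 2` in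
`E |xᵀ V x| ^ (2 * (n + 1)) = (1 + r ^ 2) ^ (2 * (n + 1)) * E |vᵢᵢ| ^ (2 * (n + 1))`, where
`x = eᵢ + r z eⱼ` and `z` is `1` or `I`. -/
theorem integral_offdiag (hV : IsCOE P V) {i j : Fin N} (hij : i ≠ j) (n : ℕ) :
    2 * (n + 1) * ∫ ω, ‖V ω i i‖ ^ (2 * n) * ‖V ω i j‖ ^ 2 ∂P =
      ∫ ω, ‖V ω i i‖ ^ (2 * (n + 1)) ∂P := by
  have := hV.isProbabilityMeasure
  set m : ℝ := ∫ ω, ‖V ω i i‖ ^ (2 * (n + 1)) ∂P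
  -- `p ω` at `w` is the `(n + 1)`-st power of the quadratic form at `eᵢ + w eⱼ`,
  -- and `S z ω` at a real `r` is `|p ω (r * z)| ^ 2`.
  set p : Ω → ℂ[X] := fun ω =>
    (C (V ω i i) + C (2 * V ω i j) * X + C (V ω j j) * X ^ 2) ^ (n + 1) with hp
  set S : ℂ → Ω → ℂ[X] := fun z ω =>
    (p ω).comp (C z * X) * ((p ω).map (starRingEnd ℂ)).comp (C (conj z) * X) with hS
  have hpdeg : ∀ ω, (p ω).natDegree ≤ (n + 1) * 2 := fun ω =>
    natDegree_pow_le_of_le _ (by compute_degree)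
  have hcomp : ∀ (f : ℂ[X]) (z : ℂ), f.natDegree ≤ (n + 1) * 2 →
      (f.comp (C z * X)).natDegree ≤ (n + 1) * 2 := fun f z hf =>
    natDegree_comp_le.trans ((Nat.mul_le_mul hf
      (by compute_degree : (C z * X).natDegree ≤ 1)).trans (by simp))
  have hdeg : ∀ z ω, (S z ω).natDegree ≤ (n + 1) * 4 := fun z ω =>
    (natDegree_mul_le_of_le (hcomp _ z (hpdeg ω))
      (hcomp _ _ (natDegree_map_le.trans (hpdeg ω)))).trans (by omega)
  have heval : ∀ (z : ℂ) (r : ℝ), (fun ω => (S z ω).eval (r : ℂ)) =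
      fun ω => ((‖V ω i i + 2 * V ω i j * (r * z) + V ω j j * (r * z) ^ 2‖ ^
        (2 * (n + 1)) : ℝ) : ℂ) := by
    intro z r
    funext ω
    simp only [hS]
    rw [eval_normSq]
    simp [hp, ← pow_mul, mul_comm 2]
  have hint : ∀ (z : ℂ) (r : ℝ), Integrable (fun ω => (S z ω).eval (r : ℂ)) P := by
    intro z r
    rw [heval]
    have hmeas : AEMeasurable (fun ω =>
        ‖V ω i i + 2 * V ω i j * (r * z) + V ω j j * (r * z) ^ 2‖ ^ (2 * (n + 1))) P :=
      (((hV.aemeasurable_entry i i).add (((hV.aemeasurable_entry i j).const_mul 2).mul_const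
        (r * z))).add ((hV.aemeasurable_entry j j).mul_const ((r * z) ^ 2))).norm.pow_const _
    suffices h : Integrable (fun ω =>
        ‖V ω i i + 2 * V ω i j * (r * z) + V ω j j * (r * z) ^ 2‖ ^ (2 * (n + 1))) P from h.ofReal
    refine Integrable.of_bound hmeas.aestronglyMeasurable
      ((1 + 2 * ‖r * z‖ + ‖r * z‖ ^ 2) ^ (2 * (n + 1))) ?_
    filter_upwards [hV.norm_entry_le] with ω h
    rw [Real.norm_of_nonneg (by positivity)]
    gcongr
    refine norm_add₃_le.trans ?_
    rw [norm_mul, norm_mul, norm_mul (V ω j j), norm_pow, Complex.norm_two]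
    have h1 := h i j
    have h2 := h j j
    gcongr
    · exact h i i
    · linarith
    · exact mul_le_of_le_one_left (by positivity) h2
  have hval : ∀ z : ℂ, ‖z‖ = 1 → ∀ r : ℝ,
      ∫ ω, (S z ω).eval (r : ℂ) ∂P = (1 + r ^ 2) ^ (2 * (n + 1)) * m := by
    intro z hz r
    have h := hV.integral_norm_form_pow i (n + 1) (Pi.single i 1 + Pi.single j (r * z))
    rw [sum_norm_sq_single hij] at h
    rw [heval, integral_complex_ofReal]
    have h' : ∫ ω, ‖V ω i i + 2 * V ω i j * (r * z) + V ω j j * (r * z) ^ 2‖ ^ (2 * (n + 1)) ∂P =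
        (1 + r ^ 2) ^ (2 * (n + 1)) * m := by
      rw [norm_mul, hz, Complex.norm_real, mul_one, Real.norm_eq_abs, sq_abs] at h
      rw [← h]
      refine integral_congr_ae ?_
      filter_upwards [hV.ae_form_eq i j] with ω hω
      rw [hω]
    rw [h']
    push_cast
    rfl
  obtain ⟨-, hkey⟩ := integral_coeff_eq (μ := P) (d := (n + 1) * 4)
    (fun ω => S 1 ω + S Complex.I ω) (C (2 * (m : ℂ)) * (1 + X ^ 2) ^ (2 * (n + 1)))
    (fun ω => natDegree_add_le_of_degree_le (hdeg _ _) (hdeg _ _))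
    ((natDegree_C_mul_le _ _).trans (natDegree_pow_le.trans ((Nat.mul_le_mul_left _
      (by compute_degree : (1 + X ^ 2 : ℂ[X]).natDegree ≤ 2)).trans (by omega))))
    (fun r => by simp only [eval_add]; exact (hint 1 r).add (hint Complex.I r))
    (fun r => by
      simp only [eval_add]
      rw [integral_add (hint 1 r) (hint Complex.I r), hval 1 (by simp), hval _ (by simp)]
      simp
      ring) 2
  have hc1 : ∀ ω, (p ω).coeff 1 = (n + 1) * V ω i i ^ n * (2 * V ω i j) := by
    intro ω
    simp only [hp]
    rw [coeff_one_pow_succ]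
    simp [coeff_X, coeff_C]
  have hc2 : ((1 + X ^ 2 : ℂ[X]) ^ (2 * (n + 1))).coeff 2 = 2 * (n + 1) := by
    have : (1 + X ^ 2 : ℂ[X]) ^ (2 * (n + 1)) = expand ℂ 2 ((1 + X) ^ (2 * (n + 1))) := by simp
    rw [this, coeff_expand two_pos]
    simp [coeff_one_add_X_pow]
  simp only [hS, coeff_two_normSq_add, hc1, coeff_C_mul, hc2] at hkey
  have hreal : ∀ ω, 2 * (‖((n : ℂ) + 1) * V ω i i ^ n * (2 * V ω i j)‖ : ℂ) ^ 2 =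
      ((8 * (n + 1) ^ 2 * (‖V ω i i‖ ^ (2 * n) * ‖V ω i j‖ ^ 2) : ℝ) : ℂ) := by
    intro ω
    have : ‖(n : ℂ) + 1‖ = n + 1 := by exact_mod_cast Complex.norm_natCast (n + 1)
    simp only [norm_mul, norm_pow, this, Complex.norm_two]
    push_cast
    ring
  simp only [hreal] at hkey
  rw [integral_complex_ofReal, integral_const_mul] at hkey
  have hkey' : 8 * ((n : ℝ) + 1) ^ 2 * ∫ ω, ‖V ω i i‖ ^ (2 * n) * ‖V ω i j‖ ^ 2 ∂P =
      2 * m * (2 * (n + 1)) := by exact_mod_cast hkey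
  have hn : (4 : ℝ) * (n + 1) ≠ 0 := by positivity
  apply mul_left_cancel₀ hn
  linarith

/-- The recursion for the diagonal moments: insert `∑ⱼ |vᵢⱼ| ^ 2 = 1` into `E |vᵢᵢ| ^ (2 n)`. The
term `j = i` is the next moment, and each of the other `N - 1` terms is a multiple of it. -/
theorem moment_succ (hV : IsCOE P V) (i : Fin N) (n : ℕ) :
    (N + 2 * n + 1) * ∫ ω, ‖V ω i i‖ ^ (2 * (n + 1)) ∂P =
      2 * (n + 1) * ∫ ω, ‖V ω i i‖ ^ (2 * n) ∂P := by
  have h1 : ∫ ω, ‖V ω i i‖ ^ (2 * n) ∂P =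
      ∑ j, ∫ ω, ‖V ω i i‖ ^ (2 * n) * ‖V ω i j‖ ^ 2 ∂P := by
    rw [← integral_finsetSum _ fun j _ => hV.integrable_norm_pow_mul i j (2 * n) 2]
    refine integral_congr_ae ?_
    filter_upwards [hV.ae_sum_norm_sq i] with ω h
    rw [← Finset.mul_sum, h, mul_one]
  have h2 : ∫ ω, ‖V ω i i‖ ^ (2 * n) * ‖V ω i i‖ ^ 2 ∂P =
      ∫ ω, ‖V ω i i‖ ^ (2 * (n + 1)) ∂P := by
    simp only [← pow_add, mul_add, mul_one]
  rw [h1, Finset.mul_sum, ← Finset.add_sum_erase _ _ (Finset.mem_univ i), h2,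
    Finset.sum_congr rfl fun j hj => hV.integral_offdiag (Finset.ne_of_mem_erase hj).symm n,
    Finset.sum_const, Finset.card_erase_of_mem (Finset.mem_univ i), Finset.card_univ,
    Fintype.card_fin, nsmul_eq_mul, Nat.cast_sub (Nat.one_le_of_lt i.2)]
  push_cast
  ring

end IsCOE

theorem theorem4p1 {Ω : Type*} [MeasurableSpace Ω] (P : Measure Ω) (N : ℕ) (hN : 1 ≤ N)
    (V : Ω → Matrix (Fin N) (Fin N) ℂ) (hV : IsCOE P V) (i : Fin N) (n : ℕ) (hn : 1 ≤ n) :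
    Integrable (fun ω => ‖V ω i i‖ ^ (2 * n)) P ∧
      ∫ ω, ‖V ω i i‖ ^ (2 * n) ∂P =
        (2 ^ n * (Nat.factorial n : ℝ)) / ∏ k ∈ Finset.Icc 1 n, ((N : ℝ) + 2 * (k : ℝ) - 1) := by
  have := hV.isProbabilityMeasure
  refine ⟨by simpa using hV.integrable_norm_pow_mul i i (2 * n) 0, ?_⟩
  -- The formula also holds for `n = 0`, which starts the induction.
  clear hn
  induction n with
  | zero => simp
  | succ n ih =>
    have hpos : (0 : ℝ) < N + 2 * n + 1 := by positivity
    have h := hV.moment_succ i n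
    rw [ih] at h
    rw [Finset.prod_Icc_succ_top (by omega), Nat.factorial_succ]
    have hfac : (N : ℝ) + 2 * ((n + 1 : ℕ) : ℝ) - 1 = N + 2 * n + 1 := by push_cast; ring
    rw [hfac, ← div_div, eq_div_iff hpos.ne', mul_comm, h]
    push_cast
    ring
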